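/- For a positive integer $n$ fix a complex primitive $n$-th root of unity $\zeta_n$. Let $G$ be a finite group; write $|x|$ for the order of $x\in G$, $x^G$ for its conjugacy class, and $\sum_{x^G}$ for the sum over a set of representatives $x$ of the conjugacy classes of $G$. The partial augmentation of $\alpha=\sum_{h\in G}\alpha_h h\in\mathbb{Z}G$ at $g\in G$ is $\varepsilon_g(\alpha)=\sum_{h\in g^G}\alpha_h$, and the distribution of partial augmentations of an element $u$ of order $n$ is the list $(\pi_d)_{d\mid n}$ of class functions $\pi_d(g)=\varepsilon_g(u^d)$. Let $\mathrm{TPA}_n(G)$ be the set of distributions of partial augmentations of the elements of $G$ of order $n$. A distribution of virtual partial augmentations of order $n$ for $G$ is a list $\pi=(\pi_d)_{d\mid n}$, indexed by the positive divisors of $n$, of class functions $\pi_d:G\to\mathbb{Z}$ such that * (V1) $\sum_{x^G}\pi_d(x)=1$ for every $d\mid n$; * (V2) $\pi_d(1)=0$ if $d\neq n$; * (V3) $\pi_d(x)=0$ if $\frac nd$ is not a multiple of $|x|$; * (V4) if $\chi$ is an ordinary character of $G$, or a Brauer character of $G$ modulo a prime not dividing $n$, and $l\in\mathbb{Z}$,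 then $$\frac1n\sum_{x^G}\sum_{d\mid n}\pi_d(x)\,\mathrm{Tr}_{\mathbb{Q}(\zeta_n^d)/\mathbb{Q}}\bigl(\chi(x)\zeta_n^{-ld}\bigr)\in\mathbb{Z}_{\ge 0},$$ where the terms with $\pi_d(x)=0$ are read as $0$ (in the other terms $x$ has order dividing $\frac nd$ by (V3), so that $\chi(x)$ is defined and lies in $\mathbb{Q}(\zeta_n^d)$). Let $\mathrm{VPA}_n(G)$ be the set of distributions of virtual partial augmentations of order $n$ for $G$. **Proposition.** Let $G=\mathrm{PSL}(2,q)$ with $q$ an odd prime power, and let $r$ be a prime not dividing $q$. Then $\mathrm{VPA}_r(G)=\mathrm{TPA}_r(G)$. -/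

import Mathlib

namespace HeLP

noncomputable section

/-! In this file `G` is meant to be a finite group.  The sum over the conjugacy classes `x^G` is a
`finsum` over `ConjClasses G`, evaluated at one representative of each class. -/

/-- `∑_{x^G} f x`: the sum of `f` over a set of representatives of the conjugacy classes. -/
def sumClasses {G A : Type*} [Group G] [AddCommMonoid A] (f : G → A) : A :=
  ∑ᶠ c : ConjClasses G, f (Quotient.out c)

/-- The partial augmentation `ε_g(α) = ∑_{h ∈ g^G} α_h` of an element of the integral group
ring. -/
def partialAug {G : Type*} [Group G] (α : MonoidAlgebra ℤ G) (g : G) : ℤ :=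
  ∑ᶠ h ∈ conjugatesOf g, α.coeff h

/-- The distribution `(g ↦ ε_g(u^d))_{d ∣ n}` of partial augmentations of `u` (meant for `u` of
order `n`). -/
def distribution {G : Type*} [Group G] (n : ℕ) (u : MonoidAlgebra ℤ G) :
    n.divisors → G → ℤ :=
  fun d g => partialAug (u ^ (d : ℕ)) g

/-- The set `TPA_n(G)` of distributions of partial augmentations of the elements of `G` of
order `n`. -/
def TPA (G : Type*) [Group G] (n : ℕ) : Set (n.divisors → G → ℤ) :=
  {π | ∃ g : G, orderOf g = n ∧ π = distribution n (MonoidAlgebra.of ℤ G g)}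

/-- A complex primitive `n`-th root of unity (for `n ≠ 0`). -/
def zeta (n : ℕ) : ℂ := Complex.exp (2 * Real.pi * Complex.I / n)

open Classical in
/-- The trace `Tr_{ℚ(ξ)/ℚ}(z)` of an element `z` of the subfield `ℚ(ξ)` of `ℂ`; the value is `0`
for `z` outside of `ℚ(ξ)`, where the trace makes no sense. -/
def traceAdjoin (ξ z : ℂ) : ℚ :=
  if h : z ∈ IntermediateField.adjoin ℚ {ξ} then
    Algebra.trace ℚ (IntermediateField.adjoin ℚ {ξ}) ⟨z, h⟩
  else 0

/-- `χ` is an ordinary character of `G`: the trace of a complex (matrix) representation. -/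
def IsOrdinaryCharacter {G : Type*} [Group G] (χ : G → ℂ) : Prop :=
  ∃ (m : ℕ) (ρ : G →* Matrix.GeneralLinearGroup (Fin m) ℂ),
    ∀ g, χ g = (ρ g : Matrix (Fin m) (Fin m) ℂ).trace

/-- The ring of all algebraic integers in `ℂ`. -/
abbrev AlgInt : Type := integralClosure ℤ ℂ

/-- `χ` is a Brauer character of `G` modulo the prime `p`.  Here `M` is a maximal ideal over `p` of
the ring of all algebraic integers, so that `AlgInt ⧸ M` is an algebraic closure of the field with
`p` elements, and reduction modulo `M` is injective on the roots of unity of order prime to `p`.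
For a representation `ρ` of `G` over `AlgInt ⧸ M`, the value of its Brauer character at a
`p`-regular element `g` is `∑ i, ξ i`, where the `ξ i` are the complex roots of unity of order prime
to `p` whose reductions modulo `M` are the eigenvalues of `ρ g`, with multiplicity.
A Brauer character is a function on the `p`-regular elements; it is extended by `0` here. -/
def IsBrauerCharacter {G : Type*} [Group G] (p : ℕ) (χ : G → ℂ) : Prop :=
  ∃ (M : Ideal AlgInt) (_ : M.IsMaximal) (_ : (p : AlgInt) ∈ M) (m : ℕ)
    (ρ : G →* Matrix.GeneralLinearGroup (Fin m) (AlgInt ⧸ M)),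
    (∀ g, ¬ p ∣ orderOf g → ∃ ξ : Fin m → AlgInt,
      (∀ i, ξ i ^ orderOf g = 1) ∧
      (ρ g : Matrix (Fin m) (Fin m) (AlgInt ⧸ M)).charpoly =
        ∏ i, (Polynomial.X - Polynomial.C (Ideal.Quotient.mk M (ξ i))) ∧
      χ g = ∑ i, (ξ i : ℂ)) ∧
    (∀ g, p ∣ orderOf g → χ g = 0)

/-- `μ(ζ_n^l, π, χ) = (1/n) ∑_{x^G} ∑_{d ∣ n} π_d(x) Tr_{ℚ(ζ_n^d)/ℚ}(χ(x) ζ_n^{-ld})`. -/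
def mult {G : Type*} [Group G] (n : ℕ) (l : ℤ) (π : n.divisors → G → ℤ) (χ : G → ℂ) : ℚ :=
  (1 / (n : ℚ)) * sumClasses fun x : G => ∑ d : n.divisors,
    (π d x : ℚ) * traceAdjoin (zeta n ^ (d : ℕ)) (χ x * zeta n ^ (-(l * ((d : ℕ) : ℤ))))

/-- A distribution of virtual partial augmentations of order `n` for `G`. -/
structure IsVirtual {G : Type*} [Group G] (n : ℕ) (π : n.divisors → G → ℤ) : Prop where
  /-- every `π_d` is a class function -/
  classFun : ∀ d x y, IsConj x y → π d x = π d y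
  /-- (V1) -/
  sum_eq_one : ∀ d, sumClasses (π d) = 1
  /-- (V2) -/
  at_one : ∀ d : n.divisors, (d : ℕ) ≠ n → π d 1 = 0
  /-- (V3) -/
  support : ∀ (d : n.divisors) (x : G), ¬ orderOf x ∣ n / (d : ℕ) → π d x = 0
  /-- (V4) -/
  nonneg_int : ∀ χ : G → ℂ,
    (IsOrdinaryCharacter χ ∨ ∃ p : ℕ, p.Prime ∧ ¬ p ∣ n ∧ IsBrauerCharacter p χ) →
    ∀ l : ℤ, ∃ k : ℕ, mult n l π χ = k

/-- The set `VPA_n(G)` of distributions of virtual partial augmentations of order `n` for `G`. -/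
def VPA (G : Type*) [Group G] (n : ℕ) : Set (n.divisors → G → ℤ) :=
  {π | IsVirtual n π}

end

end HeLP

/-!
The group `PSL(2, F)` has a three-dimensional representation in characteristic `p = char F`, the
symmetric square of the natural representation of `SL(2, F)`, and its Brauer character alone forces
a distribution `π` of virtual partial augmentations of order `r` to be that of a group element.

For `r` prime, (V1)-(V3) leave `π_r` no choice but the indicator of `1`, and `π_1` is supported on
the elements of order `r`. Let `χ` be a character whose value at `x` of order `r` is a sum
`∑ i, ξ x i` of `r`-th roots of unity. Since the trace of an `r`-th root of unity `w` is `r - 1` or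
`-1` according to whether `w = 1`, the number in (V4) is
`∑_{x^G} π_1(x) * #{i | ξ x i = ζ_r ^ l}` (`mult_eq`). For the distribution of an actual element `g`
this is the multiplicity of an eigenvalue of `g`, so that `TPA ⊆ VPA` for every finite group
(`TPA_subset_VPA`).

Conversely, suppose that each class of elements of order `r` has among its `ξ x i` a root of unity
that occurs in no other class of elements of order `r`. Then (V4) reads `π_1(x) * N ≥ 0` with
`N > 0`; so `π_1` is nonnegative on every class, and because its values sum to `1` it is the
indicator of one class (`VPA_subset_TPA_of_separating`).

The symmetric square has this property. On the image of `A ∈ SL(2, F)` its characteristic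
polynomial is `(X - 1) * (X ^ 2 - (t ^ 2 - 2) * X + 1)` with `t = tr A` (`charpoly_pslSymSq_mk`), so
any eigenvalue other than `1` determines `t ^ 2`. The order of the image being a prime other than
`p` excludes `t ^ 2 = 4` (`trace_sq_ne_four_of_orderOf`); hence an eigenvalue other than `1` exists,
and `t ^ 2` determines the conjugacy class in `PSL(2, F)` (`isConj_psl_of_trace_sq_eq`).
Finally, reduction modulo a maximal ideal over `p` is injective on `r`-th roots of unity, which
carries the separation of eigenvalues back to the complex numbers.
-/

namespace HeLP

/-! ### Traces of roots of unity of prime order -/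

open Polynomial IntermediateField

theorem traceAdjoin_one_natCast (k : ℕ) : traceAdjoin 1 (k : ℂ) = k := by
  have hfin : Module.finrank ℚ (IntermediateField.adjoin ℚ {(1 : ℂ)}) = 1 := by
    convert IntermediateField.finrank_adjoin_simple_eq_one_iff.2
      (one_mem (⊥ : IntermediateField ℚ ℂ)) using 1
  have h : (k : ℂ) ∈ IntermediateField.adjoin ℚ {(1 : ℂ)} := _root_.natCast_mem _ k
  rw [traceAdjoin, dif_pos h]
  have hk : (⟨(k : ℂ), h⟩ : IntermediateField.adjoin ℚ {(1 : ℂ)}) = algebraMap ℚ _ (k : ℚ) := by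
    ext; simp
  rw [hk, Algebra.trace_algebraMap, hfin, one_smul]

theorem traceAdjoin_sum {ι : Type*} (s : Finset ι) (ξ : ℂ) (f : ι → ℂ)
    (hf : ∀ i, f i ∈ IntermediateField.adjoin ℚ {ξ}) :
    traceAdjoin ξ (∑ i ∈ s, f i) = ∑ i ∈ s, traceAdjoin ξ (f i) := by
  have hs : ∑ i ∈ s, f i ∈ IntermediateField.adjoin ℚ {ξ} := sum_mem fun i _ => hf i
  rw [traceAdjoin, dif_pos hs]
  have : (⟨∑ i ∈ s, f i, hs⟩ : IntermediateField.adjoin ℚ {ξ}) = ∑ i ∈ s, ⟨f i, hf i⟩ := by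
    ext; simp
  rw [this, map_sum]
  exact Finset.sum_congr rfl fun i _ => by rw [traceAdjoin, dif_pos (hf i)]

theorem mem_adjoin_of_pow_eq_one {r : ℕ} (hr : r.Prime) {ζ w : ℂ} (hζ : IsPrimitiveRoot ζ r)
    (hw : w ^ r = 1) : w ∈ IntermediateField.adjoin ℚ {ζ} := by
  have := NeZero.mk hr.ne_zero
  obtain ⟨i, -, rfl⟩ := hζ.eq_pow_of_pow_eq_one hw
  exact pow_mem (mem_adjoin_simple_self ℚ ζ) i

theorem nextCoeff_cyclotomic_prime {r : ℕ} (hr : r.Prime) :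
    (cyclotomic r ℚ).nextCoeff = 1 := by
  have := Fact.mk hr
  have h2 := hr.two_le
  rw [nextCoeff_of_natDegree_pos (by
    rw [natDegree_cyclotomic]; exact Nat.totient_pos.2 hr.pos), natDegree_cyclotomic,
    Nat.totient_prime hr, cyclotomic_prime]
  simp [finsetSum_coeff, coeff_X_pow]
  omega

open Classical in
theorem trace_of_pow_eq_one {r : ℕ} (hr : r.Prime) {K : Type*} [Field K] [Algebra ℚ K]
    [IsCyclotomicExtension {r} ℚ K] {v : K} (hv : v ^ r = 1) :
    Algebra.trace ℚ K v = (if v = 1 then (r : ℚ) else 0) - 1 := by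
  have := Fact.mk hr
  have := NeZero.mk hr.ne_zero
  have hirr := cyclotomic.irreducible_rat hr.pos
  split_ifs with h
  · rw [h, ← map_one (algebraMap ℚ K), Algebra.trace_algebraMap,
      IsCyclotomicExtension.finrank _ hirr, Nat.totient_prime hr]
    simp [Nat.cast_sub hr.one_le]
  · have hprim : IsPrimitiveRoot v r := by
      rw [← orderOf_eq_prime hv h]
      exact IsPrimitiveRoot.orderOf v
    have h3 := (hprim.powerBasis ℚ).trace_gen_eq_nextCoeff_minpoly
    rw [IsPrimitiveRoot.powerBasis_gen, ← hprim.minpoly_eq_cyclotomic_of_irreducible hirr,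
      nextCoeff_cyclotomic_prime hr] at h3
    rw [h3]; ring

open Classical in
theorem traceAdjoin_of_pow_eq_one {r : ℕ} (hr : r.Prime) {ζ w : ℂ} (hζ : IsPrimitiveRoot ζ r)
    (hw : w ^ r = 1) : traceAdjoin ζ w = (if w = 1 then (r : ℚ) else 0) - 1 := by
  have := NeZero.mk hr.ne_zero
  have hmem := mem_adjoin_of_pow_eq_one hr hζ hw
  have hcyc : IsCyclotomicExtension {r} ℚ (IntermediateField.adjoin ℚ {ζ}) := by
    have h : IsCyclotomicExtension {r} ℚ (IntermediateField.adjoin ℚ {ζ}).toSubalgebra := by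
      rw [adjoin_simple_toSubalgebra_of_isAlgebraic
        ((hζ.isIntegral hr.pos).tower_top (A := ℚ)).isAlgebraic]
      exact hζ.adjoin_isCyclotomicExtension ℚ
    -- `ℚ(ζ)` carries two propositionally equal `ℚ`-algebra structures: as a subfield of `ℂ`, and as
    -- a division ring of characteristic zero (the one in `traceAdjoin`).
    have h' : @IsCyclotomicExtension {r} ℚ (IntermediateField.adjoin ℚ {ζ}) _ _
        (IntermediateField.algebra' _) := h
    convert h' using 1
    exact Subsingleton.elim _ _
  rw [traceAdjoin, dif_pos hmem, trace_of_pow_eq_one hr (by ext; simpa using hw)]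
  simp [Subtype.ext_iff]

theorem isPrimitiveRoot_zeta {n : ℕ} (hn : n ≠ 0) : IsPrimitiveRoot (zeta n) n :=
  Complex.isPrimitiveRoot_exp n hn

end HeLP

namespace HeLP

/-! ### Sums over conjugacy classes -/

section Classes

variable {G : Type*} [Group G] [Finite G]

theorem sumClasses_add {A : Type*} [AddCommMonoid A] (f g : G → A) :
    sumClasses (fun x => f x + g x) = sumClasses f + sumClasses g :=
  finsum_add_distrib (Set.toFinite _) (Set.toFinite _)

theorem sumClasses_mul {A : Type*} [NonUnitalNonAssocSemiring A] (f : G → A) (c : A) :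
    sumClasses (fun x => f x * c) = sumClasses f * c :=
  (finsum_mul' _ _ (Set.toFinite _)).symm

theorem sumClasses_intCast {A : Type*} [Ring A] (f : G → ℤ) :
    sumClasses (fun x => (f x : A)) = (sumClasses f : ℤ) :=
  ((Int.castAddHom A).map_finsum (Set.toFinite _)).symm

end Classes

theorem sumClasses_eq_of_support {G A : Type*} [Group G] [AddCommMonoid A] {f : G → A} (x₀ : G)
    (hf : ∀ x y, IsConj x y → f x = f y) (h : ∀ x, ¬ IsConj x x₀ → f x = 0) :
    sumClasses f = f x₀ := by
  have hout (c : ConjClasses G) : ConjClasses.mk (Quotient.out c) = c := Quotient.out_eq c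
  rw [sumClasses, finsum_eq_single _ (ConjClasses.mk x₀)]
  · exact hf _ _ (ConjClasses.mk_eq_mk_iff_isConj.1 (hout _))
  · intro c hc
    refine h _ fun h' => hc ?_
    rw [← hout c]
    exact ConjClasses.mk_eq_mk_iff_isConj.2 h'

/-! ### The multiplicity formula -/

/-- The divisor `1`, as an index of a distribution of order `n`. -/
abbrev divOne {n : ℕ} (hn : n ≠ 0) : n.divisors := ⟨1, Nat.one_mem_divisors.2 hn⟩

/-- The divisor `n`, as an index of a distribution of order `n`. -/
abbrev divSelf {n : ℕ} (hn : n ≠ 0) : n.divisors := ⟨n, Nat.mem_divisors_self n hn⟩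

theorem eq_divOne_or_eq_divSelf {r : ℕ} (hr : r.Prime) (d : r.divisors) :
    d = divOne hr.ne_zero ∨ d = divSelf hr.ne_zero := by
  simpa [Subtype.ext_iff] using (Nat.dvd_prime hr).1 (Nat.dvd_of_mem_divisors d.2)

theorem sum_divisors_prime {A : Type*} [AddCommMonoid A] {r : ℕ} (hr : r.Prime)
    (f : r.divisors → A) : ∑ d, f d = f (divOne hr.ne_zero) + f (divSelf hr.ne_zero) := by
  have hne : divOne hr.ne_zero ≠ divSelf hr.ne_zero := fun h =>
    hr.one_lt.ne (congrArg Subtype.val h)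
  rw [← Finset.sum_pair hne]
  congr 1
  ext d
  simpa using eq_divOne_or_eq_divSelf hr d

open Classical in
/-- If `χ x` is a sum of `r`-th roots of unity `ξ x i` for `x` of order `r`, the number `mult` of
(V4) counts the `i` with `ξ x i = ζ_r ^ l`, weighted by `π_1`. The dimension `m` contributed by `π_r`
cancels against the `-1` in the traces, as `π_1` sums to `1`. -/
theorem mult_eq {G : Type*} [Group G] [Finite G] {r : ℕ} (hr : r.Prime) (l : ℤ)
    {π : r.divisors → G → ℤ}
    (hsum : sumClasses (π (divOne hr.ne_zero)) = 1)
    (hsupp : ∀ x, orderOf x ≠ r → π (divOne hr.ne_zero) x = 0)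
    (hself : ∀ x, π (divSelf hr.ne_zero) x = if x = 1 then 1 else 0)
    {χ : G → ℂ} {m : ℕ} (hχ : χ 1 = m) {ξ : G → Fin m → ℂ}
    (hξ : ∀ x, orderOf x = r → (∀ i, ξ x i ^ r = 1) ∧ χ x = ∑ i, ξ x i) :
    mult r l π χ = sumClasses fun x =>
      (π (divOne hr.ne_zero) x : ℚ) * (Finset.univ.filter fun i => ξ x i = zeta r ^ l).card := by
  have hζ := isPrimitiveRoot_zeta hr.ne_zero
  have hζ0 : zeta r ≠ 0 := hζ.ne_zero hr.ne_zero
  have hr0 : (r : ℚ) ≠ 0 := by exact_mod_cast hr.ne_zero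
  set N : G → ℕ := fun x => (Finset.univ.filter fun i => ξ x i = zeta r ^ l).card with hN
  have h1 : ∀ x, (π (divOne hr.ne_zero) x : ℚ) * traceAdjoin (zeta r ^ 1)
        (χ x * zeta r ^ (-(l * ((1 : ℕ) : ℤ)))) =
      (π (divOne hr.ne_zero) x : ℚ) * N x * r + π (divOne hr.ne_zero) x * (-m) := by
    intro x
    by_cases hx : orderOf x = r
    · obtain ⟨hx1, hx2⟩ := hξ x hx
      have hpow : ∀ i, (ξ x i * zeta r ^ (-l)) ^ r = 1 := fun i => by
        rw [mul_pow, hx1, one_mul, ← zpow_natCast, ← zpow_mul, mul_comm, zpow_mul, zpow_natCast,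
          hζ.pow_eq_one, one_zpow]
      have hiff : ∀ i, ξ x i * zeta r ^ (-l) = 1 ↔ ξ x i = zeta r ^ l := fun i => by
        rw [zpow_neg, mul_inv_eq_one₀ (zpow_ne_zero _ hζ0)]
      rw [hx2, Nat.cast_one, mul_one, pow_one, Finset.sum_mul,
        traceAdjoin_sum _ _ _ fun i => mem_adjoin_of_pow_eq_one hr hζ (hpow i)]
      simp only [traceAdjoin_of_pow_eq_one hr hζ (hpow _), hiff, Finset.sum_sub_distrib,
        ← Finset.sum_filter, Finset.sum_const, hN, Finset.card_univ, Fintype.card_fin, nsmul_eq_mul]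
      ring
    · simp [hsupp x hx]
  have h2 : ∀ x, (π (divSelf hr.ne_zero) x : ℚ) * traceAdjoin (zeta r ^ r)
        (χ x * zeta r ^ (-(l * (r : ℤ)))) = if x = 1 then (m : ℚ) else 0 := by
    intro x
    rw [hself]
    split_ifs with hx
    · have : zeta r ^ (-(l * (r : ℤ))) = 1 := by
        rw [zpow_neg, mul_comm, zpow_mul, zpow_natCast, hζ.pow_eq_one]; simp
      rw [hx, hχ, this, hζ.pow_eq_one, mul_one, traceAdjoin_one_natCast]; simp
    · simp
  have h3 : sumClasses (fun x : G => if x = 1 then (m : ℚ) else 0) = m := by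
    rw [sumClasses_eq_of_support 1]
    · simp
    · intro x y h
      have : x = 1 ↔ y = 1 := ⟨fun hx => by rw [hx, isConj_one_right] at h; exact h,
        fun hy => by rw [hy, isConj_one_left] at h; exact h⟩
      simp [this]
    · intro x hx
      rw [if_neg]
      rintro rfl
      exact hx (IsConj.refl _)
  rw [mult]
  simp only [sum_divisors_prime hr, h1, h2]
  rw [sumClasses_add, sumClasses_add, sumClasses_mul, sumClasses_mul, h3, sumClasses_intCast, hsum]
  field_simp
  push_cast
  ring

/-! ### Distributions of group elements -/

section Distribution

variable {G : Type*} [Group G]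

open Classical in
theorem partialAug_of (g x : G) :
    partialAug (MonoidAlgebra.of ℤ G g) x = if IsConj x g then 1 else 0 := by
  rw [partialAug]
  have : ∀ h : G, (MonoidAlgebra.of ℤ G g).coeff h = if h = g then 1 else 0 := fun h => by
    simp [MonoidAlgebra.of_apply, MonoidAlgebra.coeff_single, Finsupp.single_apply, eq_comm]
  simp only [this]
  rw [finsum_mem_def, finsum_eq_single _ g]
  · simp only [Set.indicator_apply, if_true]
    exact if_congr Iff.rfl rfl rfl
  · intro h hh; simp [hh]

open Classical in
theorem distribution_of (n : ℕ) (g : G) (d : n.divisors) (x : G) :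
    distribution n (MonoidAlgebra.of ℤ G g) d x = if IsConj x (g ^ (d : ℕ)) then 1 else 0 := by
  rw [distribution, ← map_pow, partialAug_of]

end Distribution

end HeLP

namespace HeLP

/-! ### Group elements give virtual distributions -/

open Polynomial

/-- The eigenvalues of a matrix of finite order, as a family of roots of unity. -/
theorem exists_charpoly_eq_prod {K : Type*} [Field K] [IsAlgClosed K] {m : ℕ}
    {A : Matrix (Fin m) (Fin m) K} {N : ℕ} (hA : A ^ N = 1) :
    ∃ ξ : Fin m → K, (∀ i, ξ i ^ N = 1) ∧ A.charpoly = ∏ i, (X - C (ξ i)) := by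
  have hs := IsAlgClosed.splits A.charpoly
  have hcard : A.charpoly.roots.card = m := by
    rw [← hs.natDegree_eq_card_roots, A.charpoly_natDegree_eq_dim, Fintype.card_fin]
  obtain ⟨v, hv⟩ : ∃ v : Fin m → K, Finset.univ.val.map v = A.charpoly.roots := by
    obtain ⟨L, hL⟩ : ∃ L : List K, (L : Multiset K) = A.charpoly.roots :=
      ⟨_, Multiset.coe_toList _⟩
    rw [← hL, Multiset.coe_card] at hcard
    rw [← hL]
    subst hcard
    exact ⟨L.get, by rw [Fin.univ_val_map, List.ofFn_get]⟩
  refine ⟨v, fun i => ?_, ?_⟩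
  · have hi : v i ∈ A.charpoly.roots := hv ▸ Multiset.mem_map_of_mem v (Finset.mem_univ i)
    have hspec : v i ∈ spectrum K A :=
      Matrix.mem_spectrum_iff_isRoot_charpoly.2 (isRoot_of_mem_roots hi)
    have : Nonempty (Fin m) := ⟨i⟩
    have h := spectrum.pow_mem_pow A N hspec
    rwa [hA, spectrum.one_eq, Set.mem_singleton_iff] at h
  · rw [hs.eq_prod_roots_of_monic A.charpoly_monic, ← hv, Multiset.map_map]
    rfl

theorem IsOrdinaryCharacter.exists_sum {G : Type*} [Group G] {χ : G → ℂ}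
    (h : IsOrdinaryCharacter χ) :
    ∃ m : ℕ, ∀ g, ∃ ξ : Fin m → ℂ, (∀ i, ξ i ^ orderOf g = 1) ∧ χ g = ∑ i, ξ i := by
  obtain ⟨m, ρ, hρ⟩ := h
  refine ⟨m, fun g => ?_⟩
  have hpow : (ρ g : Matrix (Fin m) (Fin m) ℂ) ^ orderOf g = 1 := by
    rw [← Units.val_pow_eq_pow_val, ← map_pow, pow_orderOf_eq_one, map_one, Units.val_one]
  obtain ⟨ξ, h1, h2⟩ := exists_charpoly_eq_prod hpow
  refine ⟨ξ, h1, ?_⟩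
  rw [hρ, Matrix.trace_eq_sum_roots_charpoly, h2,
    roots_prod _ _ (Finset.prod_ne_zero_iff.2 fun i _ => X_sub_C_ne_zero _)]
  simp [Finset.sum]

theorem IsBrauerCharacter.exists_sum {G : Type*} [Group G] {p : ℕ} {χ : G → ℂ}
    (h : IsBrauerCharacter p χ) :
    ∃ m : ℕ, ∀ g, ¬ p ∣ orderOf g →
      ∃ ξ : Fin m → ℂ, (∀ i, ξ i ^ orderOf g = 1) ∧ χ g = ∑ i, ξ i := by
  obtain ⟨M, -, -, m, ρ, h, -⟩ := h
  refine ⟨m, fun g hg => ?_⟩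
  obtain ⟨ξ, h1, -, h2⟩ := h g hg
  exact ⟨fun i => ξ i, fun i => congrArg Subtype.val (h1 i), h2⟩

theorem TPA_subset_VPA {G : Type*} [Group G] [Finite G] {r : ℕ} (hr : r.Prime) :
    TPA G r ⊆ VPA G r := by
  classical
  rintro _ ⟨g, hg, rfl⟩
  have hone : ∀ x, distribution r (MonoidAlgebra.of ℤ G g) (divOne hr.ne_zero) x =
      if IsConj x g then 1 else 0 := fun x => by
    rw [distribution_of, pow_one]
  have hself : ∀ x, distribution r (MonoidAlgebra.of ℤ G g) (divSelf hr.ne_zero) x =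
      if x = 1 then 1 else 0 := fun x => by
    rw [distribution_of]
    simp only [← hg, pow_orderOf_eq_one]
    exact if_congr isConj_one_left rfl rfl
  have hclass : ∀ d x y, IsConj x y → distribution r (MonoidAlgebra.of ℤ G g) d x =
      distribution r (MonoidAlgebra.of ℤ G g) d y := fun d x y h => by
    rw [distribution_of, distribution_of]
    exact if_congr ⟨h.symm.trans, h.trans⟩ rfl rfl
  have hsum : ∀ d, sumClasses (distribution r (MonoidAlgebra.of ℤ G g) d) = 1 := fun d => by
    rw [sumClasses_eq_of_support (g ^ (d : ℕ)) (hclass d), distribution_of,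
      if_pos (IsConj.refl _)]
    intro x hx
    rw [distribution_of, if_neg hx]
  have hord : ∀ x, IsConj x g → orderOf x = r := fun x h => by
    obtain ⟨c, hc⟩ := isConj_iff.1 h
    rw [← hg, ← hc, ← MulAut.conj_apply, MulEquiv.orderOf_eq]
  refine ⟨hclass, hsum, fun d hd => ?_, fun d x hx => ?_, fun χ hχ l => ?_⟩
  · rcases eq_divOne_or_eq_divSelf hr d with rfl | rfl
    · rw [hone, if_neg]
      intro h
      have := hord _ h
      rw [orderOf_one] at this
      exact hr.one_lt.ne this
    · exact absurd rfl hd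
  · rcases eq_divOne_or_eq_divSelf hr d with rfl | rfl
    · rw [hone, if_neg]
      intro h
      exact hx (by simp [hord x h])
    · rw [hself, if_neg]
      rintro rfl
      exact hx (by simp)
  · obtain ⟨m, hm1, hm2⟩ : ∃ m : ℕ, χ 1 = m ∧ ∀ x, orderOf x = r →
        ∃ ξ : Fin m → ℂ, (∀ i, ξ i ^ r = 1) ∧ χ x = ∑ i, ξ i := by
      obtain ⟨m, hm1, hm2⟩ : ∃ m : ℕ, (∃ ξ : Fin m → ℂ, (∀ i, ξ i ^ 1 = 1) ∧ χ 1 = ∑ i, ξ i) ∧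
          ∀ x, orderOf x = r → ∃ ξ : Fin m → ℂ, (∀ i, ξ i ^ r = 1) ∧ χ x = ∑ i, ξ i := by
        rcases hχ with hχ | ⟨p, hp, hpr, hχ⟩
        · obtain ⟨m, hm⟩ := hχ.exists_sum
          exact ⟨m, by simpa using hm 1, fun x hx => hx ▸ hm x⟩
        · obtain ⟨m, hm⟩ := hχ.exists_sum
          exact ⟨m, by simpa [hp.one_lt.ne'] using hm 1, fun x hx => by
            simpa [hx, hpr] using hm x⟩
      obtain ⟨ξ, h1, h2⟩ := hm1
      exact ⟨m, by simp_all, hm2⟩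
    choose! ξ hξ using hm2
    rw [mult_eq hr l (hsum _) (fun x hx => by
      rw [hone, if_neg fun h => hx (hord x h)]) hself hm1 hξ]
    refine ⟨∑ᶠ c : ConjClasses G, if IsConj (Quotient.out c) g then
      (Finset.univ.filter fun i => ξ (Quotient.out c) i = zeta r ^ l).card else 0, ?_⟩
    rw [sumClasses, ← Nat.coe_castAddMonoidHom, AddMonoidHom.map_finsum _ (Set.toFinite _)]
    refine finsum_congr fun c => ?_
    rw [hone]
    split_ifs <;> simp
end HeLP

namespace HeLP

/-! ### Brauer characters from representations over the residue field -/

open Polynomial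

/-- `AlgInt` is integrally closed in `ℂ`. -/
theorem isIntegral_of_monic {p : AlgInt[X]} (hp : p.Monic) {z : ℂ}
    (hz : p.aeval z = 0) : IsIntegral ℤ z :=
  isIntegral_trans (R := ℤ) (A := AlgInt) z ⟨p, hp, by simpa [aeval_def] using hz⟩

/-- The residue fields of the ring of algebraic integers are algebraically closed: a monic polynomial
lifts to a monic polynomial over `AlgInt`, which has a root there. -/
instance isAlgClosed_quotient (M : Ideal AlgInt) [hM : M.IsMaximal] :
    letI := Ideal.Quotient.field M
    IsAlgClosed (AlgInt ⧸ M) := by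
  let _ := Ideal.Quotient.field M
  refine IsAlgClosed.of_exists_root _ fun p hp hirr => ?_
  have hlift : p ∈ lifts (Ideal.Quotient.mk M) := by
    rw [lifts_iff_coeff_lifts]
    exact fun n => Ideal.Quotient.mk_surjective _
  obtain ⟨P, hP, hdeg, hmon⟩ := lifts_and_degree_eq_and_monic hlift hp
  have hdegC : (P.map (algebraMap AlgInt ℂ)).degree ≠ 0 := by
    rw [hmon.degree_map, hdeg]
    exact hirr.degree_pos.ne'
  obtain ⟨z, hz⟩ := IsAlgClosed.exists_root _ hdegC
  have hz' : P.aeval z = 0 := by rwa [aeval_def, ← eval_map]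
  let w : AlgInt := ⟨z, isIntegral_of_monic hmon hz'⟩
  have hw : P.eval w = 0 := by
    apply Subtype.val_injective
    have : aeval (algebraMap AlgInt ℂ w) P = 0 := hz'
    rwa [aeval_algebraMap_apply, aeval_def, Algebra.algebraMap_self, eval₂_id] at this
  refine ⟨Ideal.Quotient.mk M w, ?_⟩
  rw [← hP, eval_map, eval₂_hom, hw, map_zero]

/-- A prime `p` is not a unit of `AlgInt`, which is integral over `ℤ`. -/
theorem exists_maximal_of_prime {p : ℕ} (hp : p.Prime) :
    ∃ M : Ideal AlgInt, M.IsMaximal ∧ (p : AlgInt) ∈ M := by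
  have hne : Ideal.span {(p : AlgInt)} ≠ ⊤ := by
    rw [Ne, Ideal.span_singleton_eq_top]
    intro h
    have h2 : IsUnit (p : ℤ) := by
      have : IsLocalHom (algebraMap ℤ AlgInt) := inferInstance
      exact (isUnit_map_iff (algebraMap ℤ AlgInt) (p : ℤ)).1 (by simpa using h)
    exact (Nat.prime_iff_prime_int.1 hp).not_isUnit h2
  obtain ⟨M, hM, hle⟩ := Ideal.exists_le_maximal _ hne
  exact ⟨M, hM, hle (Ideal.mem_span_singleton_self _)⟩

theorem exists_ringHom_of_charP (F K : Type*) [Field F] [Finite F] [Field K] [IsAlgClosed K]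
    (p : ℕ) [CharP F p] [CharP K p] : Nonempty (F →+* K) := by
  have : Fact p.Prime := ⟨CharP.char_is_prime F p⟩
  let _ := ZMod.algebra F p
  let _ := ZMod.algebra K p
  exact ⟨(IsAlgClosed.lift (R := ZMod p) (S := F) (M := K)).toRingHom⟩

theorem exists_primitiveRoot_algInt {N : ℕ} (hN : N ≠ 0) : ∃ ζ : AlgInt, IsPrimitiveRoot ζ N := by
  have h := Complex.isPrimitiveRoot_exp N hN
  exact ⟨⟨_, h.isIntegral (Nat.pos_of_ne_zero hN)⟩,
    IsPrimitiveRoot.of_map_of_injective (f := algebraMap AlgInt ℂ) h Subtype.val_injective⟩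

theorem exists_pow_eq_one_lift (M : Ideal AlgInt) [M.IsPrime] {N : ℕ} (hN : N ≠ 0)
    {a : AlgInt ⧸ M} (ha : a ^ N = 1) : ∃ ξ : AlgInt, ξ ^ N = 1 ∧ Ideal.Quotient.mk M ξ = a := by
  obtain ⟨ζ, hζ⟩ := exists_primitiveRoot_algInt hN
  have h := congrArg (fun P => (P.map (Ideal.Quotient.mk M)).eval a)
    (X_pow_sub_one_eq_prod (Nat.pos_of_ne_zero hN) hζ)
  simp only [Polynomial.map_sub, Polynomial.map_pow, map_X, Polynomial.map_one, eval_sub,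
    eval_pow, eval_X, eval_one, ha, sub_self, Polynomial.map_prod, eval_prod, map_C, eval_C] at h
  obtain ⟨ξ, hξ, h0⟩ := Finset.prod_eq_zero_iff.1 h.symm
  exact ⟨ξ, (mem_nthRootsFinset (Nat.pos_of_ne_zero hN) 1).1 hξ, (sub_eq_zero.1 h0).symm⟩

/-- Every representation over a residue field of `AlgInt` has a Brauer character, coming with the
lifts `ξ g` of the eigenvalues at each `p`-regular element `g`. -/
theorem isBrauerCharacter_of_rep {G : Type*} [Group G] [Finite G] {p : ℕ} (M : Ideal AlgInt)
    [hM : M.IsMaximal] (hp : (p : AlgInt) ∈ M) {m : ℕ}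
    (ρ : G →* Matrix.GeneralLinearGroup (Fin m) (AlgInt ⧸ M)) :
    ∃ (χ : G → ℂ) (ξ : G → Fin m → AlgInt), IsBrauerCharacter p χ ∧ ∀ g, ¬ p ∣ orderOf g →
      (∀ i, ξ g i ^ orderOf g = 1) ∧
      (ρ g : Matrix (Fin m) (Fin m) (AlgInt ⧸ M)).charpoly =
        ∏ i, (X - C (Ideal.Quotient.mk M (ξ g i))) ∧ χ g = ∑ i, (ξ g i : ℂ) := by
  classical
  have key : ∀ g, ∃ ξ : Fin m → AlgInt, (∀ i, ξ i ^ orderOf g = 1) ∧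
      (ρ g : Matrix (Fin m) (Fin m) (AlgInt ⧸ M)).charpoly =
        ∏ i, (X - C (Ideal.Quotient.mk M (ξ i))) := by
    intro g
    have hpow : (ρ g : Matrix (Fin m) (Fin m) (AlgInt ⧸ M)) ^ orderOf g = 1 := by
      rw [← Units.val_pow_eq_pow_val, ← map_pow, pow_orderOf_eq_one, map_one, Units.val_one]
    let _ := Ideal.Quotient.field M
    obtain ⟨a, h1, h2⟩ := exists_charpoly_eq_prod (K := AlgInt ⧸ M) (A := (ρ g).val) hpow
    choose ξ hξ1 hξ2 using fun i => exists_pow_eq_one_lift M (orderOf_pos g).ne' (h1 i)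
    exact ⟨ξ, hξ1, by simpa only [hξ2] using h2⟩
  choose ξ h1 h2 using key
  refine ⟨fun g => if p ∣ orderOf g then 0 else ∑ i, (ξ g i : ℂ), ξ,
    ⟨M, hM, hp, m, ρ, fun g hg => ⟨ξ g, h1 g, h2 g, if_neg hg⟩, fun g hg => if_pos hg⟩,
    fun g hg => ⟨h1 g, h2 g, if_neg hg⟩⟩
end HeLP

namespace HeLP

open Matrix

/-! ### Conjugacy in `SL(2, F)` and `PSL(2, F)` -/

/-- A nondegenerate binary quadratic form over a finite field of odd characteristic represents
`1`. -/
theorem exists_binary_quadratic_eq_one {F : Type*} [Field F] [Finite F] (h2 : (2 : F) ≠ 0)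
    {a b c : F} (hdisc : b ^ 2 - 4 * a * c ≠ 0) :
    ∃ x y : F, a * x ^ 2 + b * x * y + c * y ^ 2 = 1 := by
  classical
  let _ := Fintype.ofFinite F
  by_cases ha : a = 0
  · have hb : b ≠ 0 := by rintro rfl; simp [ha] at hdisc
    refine ⟨(1 - c) / b, 1, ?_⟩
    rw [ha]
    field_simp
    ring
  · have h4 : (4 : F) * a ≠ 0 := mul_ne_zero (by
      rw [show (4 : F) = 2 * 2 by norm_num]; exact mul_ne_zero h2 h2) ha
    -- Completing the square turns the form into `a x² + k y²`.
    set k : F := -(b ^ 2 - 4 * a * c) / (4 * a) with hk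
    have hk0 : k ≠ 0 := div_ne_zero (neg_ne_zero.2 hdisc) h4
    have hcard : Fintype.card F % 2 = 1 := by
      refine FiniteField.odd_card_of_char_ne_two fun h => h2 ?_
      have := ringChar.charP F
      rw [h] at this
      exact CharP.cast_eq_zero F 2
    obtain ⟨x, y, hxy⟩ := FiniteField.exists_root_sum_quadratic
      (f := Polynomial.C a * Polynomial.X ^ 2 + Polynomial.C 0 * Polynomial.X + Polynomial.C (-1))
      (g := Polynomial.C k * Polynomial.X ^ 2 + Polynomial.C 0 * Polynomial.X + Polynomial.C 0)
      (Polynomial.degree_quadratic ha) (Polynomial.degree_quadratic hk0) hcard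
    simp only [Polynomial.eval_add, Polynomial.eval_mul, Polynomial.eval_C, Polynomial.eval_pow,
      Polynomial.eval_X] at hxy
    refine ⟨x - b / (2 * a) * y, y, ?_⟩
    have h4a : k * (4 * a) = -(b ^ 2 - 4 * a * c) := div_mul_cancel₀ _ h4
    have : a * (x - b / (2 * a) * y) ^ 2 + b * (x - b / (2 * a) * y) * y + c * y ^ 2 =
        a * x ^ 2 + k * y ^ 2 := by
      have hb : b / (2 * a) * (2 * a) = b := div_mul_cancel₀ _ (mul_ne_zero h2 ha)
      generalize b / (2 * a) = e at hb
      have hke : k = c - a * e ^ 2 := by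
        apply mul_right_cancel₀ h4
        rw [h4a, ← hb]
        ring
      rw [hke, ← hb]
      ring
    rw [this]
    linear_combination hxy

/-- The companion matrix of `X² - tX + 1`, an element of `SL(2, F)`. -/
def companionSL {F : Type*} [CommRing F] (t : F) : SpecialLinearGroup (Fin 2) F :=
  ⟨!![0, -1; 1, t], by simp [det_fin_two]⟩

/-- An element `A` of `SL(2, F)` with trace different from `±2` is conjugate in `SL(2, F)`, and not
only in `GL(2, F)`, to a companion matrix: `v ↦ det (v, A v)` is a quadratic form of discriminant
`(tr A) ^ 2 - 4`, and a vector `v` at which it is `1` gives a conjugating matrix with columns `v`,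
`A v` and determinant `1`. -/
theorem isConj_companionSL {F : Type*} [Field F] [Finite F] (h2 : (2 : F) ≠ 0)
    (A : SpecialLinearGroup (Fin 2) F) (hA : A.1.trace ^ 2 ≠ 4) :
    IsConj (companionSL A.1.trace) A := by
  have hdet := A.2
  rw [det_fin_two] at hdet
  rw [trace_fin_two] at hA
  obtain ⟨x, y, hxy⟩ := exists_binary_quadratic_eq_one h2
    (a := A.1 1 0) (b := A.1 1 1 - A.1 0 0) (c := -A.1 0 1) (fun h => hA (by
      linear_combination h + 4 * hdet))
  let P : SpecialLinearGroup (Fin 2) F :=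
    ⟨!![x, A.1 0 0 * x + A.1 0 1 * y; y, A.1 1 0 * x + A.1 1 1 * y], by
      rw [det_fin_two]; simp; linear_combination hxy⟩
  refine isConj_iff.2 ⟨P, mul_inv_eq_iff_eq_mul.2 (Subtype.ext ?_)⟩
  change P.1 * (companionSL A.1.trace).1 = A.1 * P.1
  ext i j
  fin_cases i <;> fin_cases j <;>
    simp [P, companionSL, Matrix.mul_apply, Fin.sum_univ_two, trace_fin_two]
  · linear_combination x * hdet
  · linear_combination y * hdet

theorem isConj_of_trace_eq {F : Type*} [Field F] [Finite F] (h2 : (2 : F) ≠ 0)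
    {A B : SpecialLinearGroup (Fin 2) F} (hA : A.1.trace ^ 2 ≠ 4)
    (hAB : A.1.trace = B.1.trace) : IsConj A B := by
  have h := isConj_companionSL h2 B (hAB ▸ hA)
  rw [← hAB] at h
  exact (isConj_companionSL h2 A hA).symm.trans h

theorem isConj_psl_of_trace_sq_eq {F : Type*} [Field F] [Finite F] (h2 : (2 : F) ≠ 0)
    {A B : SpecialLinearGroup (Fin 2) F} (hA : A.1.trace ^ 2 ≠ 4)
    (hAB : A.1.trace ^ 2 = B.1.trace ^ 2) :
    IsConj (A : ProjectiveSpecialLinearGroup (Fin 2) F) (B : ProjectiveSpecialLinearGroup (Fin 2) F) := by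
  let π := QuotientGroup.mk' (Subgroup.center (SpecialLinearGroup (Fin 2) F))
  rcases sq_eq_sq_iff_eq_or_eq_neg.1 hAB with h | h
  · exact π.map_isConj (isConj_of_trace_eq h2 hA h)
  · have hB : IsConj A (-B) := isConj_of_trace_eq h2 hA (by simp [h])
    have : (B : ProjectiveSpecialLinearGroup (Fin 2) F) = ((-B : SpecialLinearGroup (Fin 2) F) :
        ProjectiveSpecialLinearGroup (Fin 2) F) := by
      rw [QuotientGroup.eq, Matrix.SpecialLinearGroup.mem_center_iff]
      refine ⟨-1, by simp, ?_⟩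
      rw [mul_neg, inv_mul_cancel]
      ext i j
      simp only [SpecialLinearGroup.coe_neg]
      fin_cases i <;> fin_cases j <;> simp
    rw [this]
    exact π.map_isConj hB

/-- If `(tr A) ^ 2 = 4`, then `A` is, up to sign, unipotent, so that the order of its image in
`PSL(2, F)` divides the characteristic. -/
theorem trace_sq_ne_four_of_orderOf {F : Type*} [Field F] {p : ℕ} [Fact p.Prime] [CharP F p]
    (h2 : (2 : F) ≠ 0) {r : ℕ} (hr : r.Prime) (hrp : r ≠ p) {A : SpecialLinearGroup (Fin 2) F}
    (hA : orderOf (A : ProjectiveSpecialLinearGroup (Fin 2) F) = r) : A.1.trace ^ 2 ≠ 4 := by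
  intro ht
  have hp : p.Prime := Fact.out
  have hdet := A.2
  rw [det_fin_two] at hdet
  rw [trace_fin_two] at ht
  set s : F := (A.1 0 0 + A.1 1 1) / 2 with hs
  have hs2 : s * 2 = A.1 0 0 + A.1 1 1 := div_mul_cancel₀ _ h2
  have hs1 : s ^ 2 = 1 := by
    rw [hs, div_pow, ht, show (2 : F) ^ 2 = 4 by norm_num, div_self]
    rw [show (4 : F) = 2 * 2 by norm_num]; exact mul_ne_zero h2 h2
  have hsq : (A.1 - scalar (Fin 2) s) ^ 2 = 0 := by
    rw [sq]
    ext i j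
    fin_cases i <;> fin_cases j <;> simp [Matrix.mul_apply, Fin.sum_univ_two]
    · linear_combination (-A.1 0 0) * hs2 + hs1 - hdet
    · linear_combination (-A.1 0 1) * hs2
    · linear_combination (-A.1 1 0) * hs2
    · linear_combination (-A.1 1 1) * hs2 + hs1 - hdet
  have hpow : A.1 ^ p = scalar (Fin 2) (s ^ p) := by
    have h := sub_pow_char_of_commute (p := p)
      (scalar_commute s (fun r' => mul_comm _ _) A.1).symm
    rw [pow_eq_zero_of_le hp.two_le hsq] at h
    rw [map_pow]
    exact (sub_eq_zero.1 h.symm)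
  have hone : (A : ProjectiveSpecialLinearGroup (Fin 2) F) ^ p = 1 := by
    rw [← QuotientGroup.mk_pow, QuotientGroup.eq_one_iff, Matrix.SpecialLinearGroup.mem_center_iff]
    refine ⟨s ^ p, ?_, ?_⟩
    · rw [Fintype.card_fin, ← pow_mul, mul_comm, pow_mul, hs1, one_pow]
    · rw [← hpow]; rfl
  exact hrp ((Nat.prime_dvd_prime_iff_eq hr hp).1 (hA ▸ orderOf_dvd_of_pow_eq_one hone))

/-! ### The symmetric square -/

/-- The symmetric square of a `2 × 2` matrix, in the basis `e₁²`, `e₁e₂`, `e₂²`. -/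
def symSq {R : Type*} [CommRing R] :
    Matrix (Fin 2) (Fin 2) R →* Matrix (Fin 3) (Fin 3) R where
  toFun A := !![A 0 0 ^ 2, A 0 0 * A 0 1, A 0 1 ^ 2;
    2 * A 0 0 * A 1 0, A 0 0 * A 1 1 + A 0 1 * A 1 0, 2 * A 0 1 * A 1 1;
    A 1 0 ^ 2, A 1 0 * A 1 1, A 1 1 ^ 2]
  map_one' := by
    ext i j
    fin_cases i <;> fin_cases j <;> simp
  map_mul' A B := by
    ext i j
    fin_cases i <;> fin_cases j <;>
      simp [Matrix.mul_apply, Fin.sum_univ_two, Fin.sum_univ_three] <;> ring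

open Polynomial in
theorem charpoly_symSq {R : Type*} [CommRing R] (A : Matrix (Fin 2) (Fin 2) R) :
    (symSq A).charpoly =
      (X - C A.det) * (X ^ 2 - C (A.trace ^ 2 - 2 * A.det) * X + C A.det ^ 2) := by
  rw [Matrix.charpoly, Matrix.det_fin_three, Matrix.det_fin_two, Matrix.trace_fin_two]
  have h2 : (C 2 : R[X]) = 2 := map_ofNat C 2
  simp [symSq, h2]
  ring

/-- The symmetric square of the natural representation of `SL(2, F)`, with scalars extended along
`φ : F →+* K`; it factors through `PSL(2, F)`. -/
def pslSymSq {F K : Type*} [CommRing F] [CommRing K] (φ : F →+* K) :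
    ProjectiveSpecialLinearGroup (Fin 2) F →* GeneralLinearGroup (Fin 3) K :=
  QuotientGroup.lift _
    (((Units.map symSq).comp SpecialLinearGroup.toGL).comp (SpecialLinearGroup.map φ)) <| by
      intro A hA
      obtain ⟨s, hs, hsA⟩ := Matrix.SpecialLinearGroup.mem_center_iff.1 hA
      have hs1 : φ s ^ 2 = 1 := by rw [← map_pow]; simpa using congrArg φ hs
      ext i j
      fin_cases i <;> fin_cases j <;>
        simp [symSq, ← hsA, hs1, ← sq]

theorem pslSymSq_mk {F K : Type*} [CommRing F] [CommRing K] (φ : F →+* K)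
    (A : SpecialLinearGroup (Fin 2) F) :
    (pslSymSq φ (A : ProjectiveSpecialLinearGroup (Fin 2) F)).val = symSq (A.1.map φ) := rfl

open Polynomial in
theorem charpoly_pslSymSq_mk {F K : Type*} [CommRing F] [CommRing K] (φ : F →+* K)
    (A : SpecialLinearGroup (Fin 2) F) :
    (pslSymSq φ (A : ProjectiveSpecialLinearGroup (Fin 2) F)).val.charpoly =
      (X - 1) * (X ^ 2 - C (φ (A.1.trace ^ 2) - 2) * X + 1) := by
  have hdet : (A.1.map φ).det = 1 := by
    rw [← RingHom.mapMatrix_apply, ← RingHom.map_det, A.2, map_one]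
  have htr : (A.1.map φ).trace = φ A.1.trace := by simp [trace_fin_two]
  rw [pslSymSq_mk, charpoly_symSq, hdet, htr]
  simp

end HeLP

namespace HeLP

/-! ### Virtual distributions come from group elements -/

open Polynomial

theorem exists_eq_one_of_finsum_eq_one {ι : Type*} [Finite ι] {f : ι → ℤ} (hf : ∀ i, 0 ≤ f i)
    (hsum : ∑ᶠ i, f i = 1) : ∃ i₀, f i₀ = 1 ∧ ∀ i, i ≠ i₀ → f i = 0 := by
  classical
  let _ := Fintype.ofFinite ι
  rw [finsum_eq_sum_of_fintype] at hsum
  obtain ⟨i₀, -, hi₀⟩ : ∃ i₀ ∈ Finset.univ, f i₀ ≠ 0 :=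
    Finset.exists_ne_zero_of_sum_ne_zero (by rw [hsum]; exact one_ne_zero)
  rw [← Finset.add_sum_erase _ _ (Finset.mem_univ i₀)] at hsum
  have hpos := (hf i₀).lt_of_ne hi₀.symm
  have hrest := Finset.sum_nonneg fun i (_ : i ∈ Finset.univ.erase i₀) => hf i
  have hzero : ∑ i ∈ Finset.univ.erase i₀, f i = 0 := by omega
  refine ⟨i₀, by omega, fun i hi => ?_⟩
  exact (Finset.sum_eq_zero_iff_of_nonneg fun i _ => hf i).1 hzero i
    (Finset.mem_erase.2 ⟨hi, Finset.mem_univ i⟩)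

/-- `VPA ⊆ TPA` in prime order `r` as soon as a single character `χ` separates the classes of elements
of order `r`: each class has an eigenvalue that occurs in no other such class. -/
theorem VPA_subset_TPA_of_separating {G : Type*} [Group G] [Finite G] {r : ℕ} (hr : r.Prime)
    {χ : G → ℂ}
    (hχ : IsOrdinaryCharacter χ ∨ ∃ p : ℕ, p.Prime ∧ ¬ p ∣ r ∧ IsBrauerCharacter p χ)
    {m : ℕ} (hχ1 : χ 1 = m) {ξ : G → Fin m → ℂ}
    (hξ : ∀ x, orderOf x = r → (∀ i, ξ x i ^ r = 1) ∧ χ x = ∑ i, ξ x i)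
    (hsep : ∀ x, orderOf x = r → ∃ i, ∀ y, orderOf y = r → ∀ j, ξ y j = ξ x i → IsConj y x) :
    VPA G r ⊆ TPA G r := by
  classical
  intro π hπ
  have := NeZero.mk hr.ne_zero
  have hself : ∀ x, π (divSelf hr.ne_zero) x = if x = 1 then 1 else 0 := by
    have h0 : ∀ x, x ≠ 1 → π (divSelf hr.ne_zero) x = 0 := fun x hx =>
      hπ.support _ x (by simpa [Nat.div_self hr.pos] using hx)
    intro x
    split_ifs with hx
    · rw [hx, ← hπ.sum_eq_one (divSelf hr.ne_zero), sumClasses_eq_of_support 1 (hπ.classFun _)]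
      intro y hy
      exact h0 y fun h => hy (h ▸ IsConj.refl _)
    · exact h0 x hx
  set ε := π (divOne hr.ne_zero) with hε
  have hsum : sumClasses ε = 1 := hπ.sum_eq_one _
  have hclass : ∀ x y, IsConj x y → ε x = ε y := hπ.classFun _
  have hsupp : ∀ x, orderOf x ≠ r → ε x = 0 := by
    intro x hx
    by_cases h1 : orderOf x = 1
    · rw [orderOf_eq_one_iff.1 h1]
      exact hπ.at_one _ hr.one_lt.ne
    · refine hπ.support _ x fun h => ?_
      rw [Nat.div_one, Nat.dvd_prime hr] at h
      tauto
  have hout (c : ConjClasses G) : ConjClasses.mk (Quotient.out c) = c := Quotient.out_eq c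
  have hnonneg : ∀ c : ConjClasses G, 0 ≤ ε (Quotient.out c) := by
    intro c
    by_cases hc : orderOf (Quotient.out c) = r
    · obtain ⟨i, hi⟩ := hsep _ hc
      obtain ⟨l, -, hl⟩ := (isPrimitiveRoot_zeta hr.ne_zero).eq_pow_of_pow_eq_one ((hξ _ hc).1 i)
      -- Only the class `c` contributes to the multiplicity of this eigenvalue.
      obtain ⟨k, hk⟩ := hπ.nonneg_int χ hχ l
      rw [mult_eq hr l hsum hsupp hself hχ1 hξ, sumClasses, finsum_eq_single _ c] at hk
      · set N := (Finset.univ.filter fun i => ξ (Quotient.out c) i = zeta r ^ (l : ℤ)).card with hN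
        have hNpos : 0 < N := by
          refine Finset.card_pos.2 ⟨i, ?_⟩
          simp [← hl]
        have hk' : ε (Quotient.out c) * N = k := by exact_mod_cast hk
        by_contra hneg
        have := mul_neg_of_neg_of_pos (not_le.1 hneg) (Int.natCast_pos.2 hNpos)
        omega
      · intro c' hc'
        by_cases ho : orderOf (Quotient.out c') = r
        · rw [Finset.filter_eq_empty_iff.2, Finset.card_empty, Nat.cast_zero, mul_zero]
          intro j _ hj
          rw [zpow_natCast, hl] at hj
          refine hc' ?_
          rw [← hout c', ← hout c]
          exact ConjClasses.mk_eq_mk_iff_isConj.2 (hi _ ho j hj)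
        · rw [← hε, hsupp _ ho, Int.cast_zero, zero_mul]
    · rw [hsupp _ hc]
  obtain ⟨c₀, h1, h0⟩ : ∃ c₀ : ConjClasses G, ε (Quotient.out c₀) = 1 ∧
      ∀ c, c ≠ c₀ → ε (Quotient.out c) = 0 :=
    exists_eq_one_of_finsum_eq_one hnonneg hsum
  have hord : orderOf (Quotient.out c₀) = r := by
    by_contra h
    rw [hsupp _ h] at h1
    exact zero_ne_one h1
  refine ⟨Quotient.out c₀, hord, ?_⟩
  funext d x
  rw [distribution_of]
  rcases eq_divOne_or_eq_divSelf hr d with rfl | rfl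
  · have hx : IsConj x (Quotient.out (ConjClasses.mk x)) :=
      (ConjClasses.mk_eq_mk_iff_isConj.1 (hout _)).symm
    rw [pow_one, ← hε, hclass _ _ hx]
    split_ifs with h
    · rw [ConjClasses.mk_eq_mk_iff_isConj.2 h, hout, h1]
    · exact h0 _ fun h' => h (by rwa [h'] at hx)
  · have hpow : Quotient.out c₀ ^ r = 1 := hord ▸ pow_orderOf_eq_one _
    rw [hself]
    simp only [hpow]
    exact if_congr isConj_one_left.symm rfl rfl

/-- Reduction of `r`-th roots of unity has trivial kernel if `r` does not vanish in the target:
for `ξ ≠ 1` the sum `∑ i < r, ξ ^ i` vanishes, but it would reduce to `r` if `ξ` reduced to `1`. -/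
theorem mk_ne_one_of_pow_eq_one {R : Type*} [CommRing R] [IsDomain R] {S : Type*} [CommRing S]
    (f : R →+* S) {r : ℕ} (hr : (r : S) ≠ 0) {ξ : R} (hξ : ξ ^ r = 1) (h1 : ξ ≠ 1) :
    f ξ ≠ 1 := by
  intro h
  have hgeom : ∑ i ∈ Finset.range r, ξ ^ i = 0 := by
    have := geom_sum_mul ξ r
    rw [hξ, sub_self] at this
    exact (mul_eq_zero.1 this).resolve_right (sub_ne_zero.2 h1)
  have := congrArg f hgeom
  simp [h] at this
  exact hr this

end HeLP

/-! ### Separation of classes in `PSL(2, F)` by the symmetric square -/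

open HeLP Polynomial in
theorem proposition4p2 (F : Type*) [Field F] [Finite F] (q : ℕ) (hq : Nat.card F = q)
    (hodd : Odd q) (r : ℕ) (hr : r.Prime) (hrq : ¬ r ∣ q) :
    HeLP.VPA (Matrix.ProjectiveSpecialLinearGroup (Fin 2) F) r =
      HeLP.TPA (Matrix.ProjectiveSpecialLinearGroup (Fin 2) F) r := by
  refine Set.Subset.antisymm ?_ (TPA_subset_VPA hr)
  obtain ⟨p, hpF⟩ := CharP.exists F
  have hp : p.Prime := CharP.char_is_prime F p
  have hpfact := Fact.mk hp
  have hpq : p ∣ q := by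
    let _ := Fintype.ofFinite F
    obtain ⟨n, -, hn⟩ := FiniteField.card F p
    rw [← hq, Nat.card_eq_fintype_card, hn]
    exact dvd_pow_self p n.ne_zero
  have hrp : r ≠ p := fun h => hrq (h ▸ hpq)
  have hp2 : p ≠ 2 := by
    rintro rfl
    exact (Nat.not_even_iff_odd.2 hodd) (even_iff_two_dvd.2 hpq)
  have hpr : ¬ p ∣ r := fun h => hrp ((Nat.prime_dvd_prime_iff_eq hp hr).1 h).symm
  have h2F : (2 : F) ≠ 0 := fun h => hp2 <|
    (Nat.prime_dvd_prime_iff_eq hp Nat.prime_two).1 ((CharP.cast_eq_zero_iff F p 2).1 (by simpa using h))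
  obtain ⟨M, hM, hpM⟩ := exists_maximal_of_prime hp
  let _ := Ideal.Quotient.field M
  have hpK : CharP (AlgInt ⧸ M) p := (CharP.charP_iff_prime_eq_zero hp).2 <| by
    rw [← map_natCast (Ideal.Quotient.mk M)]
    exact Ideal.Quotient.eq_zero_iff_mem.2 hpM
  have hrK : (r : AlgInt ⧸ M) ≠ 0 := fun h => hpr ((CharP.cast_eq_zero_iff _ p r).1 h)
  have h2K : (2 : AlgInt ⧸ M) ≠ 0 := fun h => hp2 <|
    (Nat.prime_dvd_prime_iff_eq hp Nat.prime_two).1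
      ((CharP.cast_eq_zero_iff (AlgInt ⧸ M) p 2).1 (by simpa using h))
  obtain ⟨φ⟩ := exists_ringHom_of_charP F (AlgInt ⧸ M) p
  obtain ⟨χ, ξ, hχ, hξ⟩ := isBrauerCharacter_of_rep M hpM (pslSymSq φ)
  have hξr : ∀ x, orderOf x = r → _ := fun x hx => hξ x (by rwa [hx])
  have hχ1 : χ 1 = (3 : ℕ) := by
    obtain ⟨h1, -, h3⟩ := hξ 1 (by simpa using hp.one_lt.ne')
    rw [h3]
    simp only [orderOf_one, pow_one] at h1
    simp [h1]
  refine VPA_subset_TPA_of_separating hr (Or.inr ⟨p, hp, hpr, hχ⟩) hχ1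
    (ξ := fun x i => (ξ x i : ℂ)) (fun x hx => ?_) fun x hx => ?_
  · obtain ⟨h1, -, h3⟩ := hξr x hx
    rw [hx] at h1
    exact ⟨fun i => congrArg Subtype.val (h1 i), h3⟩
  · obtain ⟨A, rfl⟩ := QuotientGroup.mk_surjective x
    obtain ⟨hA1, hA2, -⟩ := hξr _ hx
    have hA4 := trace_sq_ne_four_of_orderOf h2F hr hrp hx
    rw [charpoly_pslSymSq_mk] at hA2
    rw [hx] at hA1
    obtain ⟨i, hi⟩ : ∃ i, ξ (A : Matrix.ProjectiveSpecialLinearGroup (Fin 2) F) i ≠ 1 := by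
      by_contra! hall
      -- Otherwise the characteristic polynomial is `(X - 1) ^ 3`; comparing values at `-1` gives
      -- `(tr A) ^ 2 = 4`.
      have h := congrArg (eval (-1)) hA2
      simp only [hall, map_one, Finset.prod_const, Finset.card_univ, Fintype.card_fin, eval_mul,
        eval_sub, eval_X, eval_one, eval_add, eval_pow, eval_C] at h
      have h' : 2 * (φ (A.1.trace ^ 2) - φ 4) = 0 := by
        rw [map_ofNat]
        linear_combination -h
      rw [mul_eq_zero, or_iff_right h2K, sub_eq_zero] at h'
      exact hA4 (φ.injective h')
    refine ⟨i, fun y hy j hj => ?_⟩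
    obtain ⟨B, rfl⟩ := QuotientGroup.mk_surjective y
    obtain ⟨hB1, hB2, -⟩ := hξr _ hy
    rw [charpoly_pslSymSq_mk] at hB2
    replace hj := Subtype.val_injective hj
    set w := Ideal.Quotient.mk M (ξ (A : Matrix.ProjectiveSpecialLinearGroup (Fin 2) F) i) with hw
    have hw1 : w ≠ 1 := mk_ne_one_of_pow_eq_one (Ideal.Quotient.mk M) hrK (hA1 i) hi
    have hw0 : w ≠ 0 := by
      intro h0
      have h := congrArg (Ideal.Quotient.mk M) (hA1 i)
      rw [map_pow, ← hw, h0, map_one, zero_pow hr.ne_zero] at h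
      exact zero_ne_one h
    have hroot : ∀ C : Matrix.SpecialLinearGroup (Fin 2) F, ∀ k,
        Ideal.Quotient.mk M (ξ (C : Matrix.ProjectiveSpecialLinearGroup (Fin 2) F) k) = w →
        (X - 1) * (X ^ 2 - Polynomial.C (φ (C.1.trace ^ 2) - 2) * X + 1) = ∏ i, (X -
          Polynomial.C (Ideal.Quotient.mk M
            (ξ (C : Matrix.ProjectiveSpecialLinearGroup (Fin 2) F) i))) →
        w ^ 2 - (φ (C.1.trace ^ 2) - 2) * w + 1 = 0 := by
      intro C k hk hC
      have h := congrArg (eval w) hC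
      rw [eval_prod, Finset.prod_eq_zero (Finset.mem_univ k) (by simp [hk])] at h
      simp only [eval_mul, eval_sub, eval_X, eval_one, eval_add, eval_pow, eval_C] at h
      exact (mul_eq_zero.1 h).resolve_left (sub_ne_zero.2 hw1)
    have hrA := hroot A i rfl hA2
    have hrB := hroot B j (by rw [hj]) hB2
    have htr : B.1.trace ^ 2 = A.1.trace ^ 2 := by
      apply φ.injective
      apply mul_right_cancel₀ hw0
      linear_combination hrA - hrB
    exact isConj_psl_of_trace_sq_eq h2F (htr ▸ hA4) htr
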